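/- Fix $n\ge 1$ and let $\mathbb{T}^n=(\mathbb{R}/\mathbb{Z})^n$. Let $\mathcal{B}$ be a Banach algebra completion of the group algebra $\mathbb{C}[\mathbb{Z}^n]$ that is continuously contained in $C(\mathbb{T}^n)$. That is, $\mathcal{B}$ is a complex unital Banach algebra containing $\mathbb{C}[\mathbb{Z}^n]$ as a dense unital subalgebra, together with a continuous injective unital algebra homomorphism $\iota:\mathcal{B}\hookrightarrow C(\mathbb{T}^n)$ which sends the group element $m\in\mathbb{Z}^n$ to the character $\theta\mapsto e^{2\pi i\langle m,\theta\rangle}$. Let $s_1,\dots,s_n\in\mathbb{C}[\mathbb{Z}^n]$ be the group elements given by the canonical basis of $\mathbb{Z}^n$, and write $s_i^*=s_i^{-1}$. Assume that for every $i=1,\dots,n$ the series $$\frac{2}{\pi}\Bigl(1-\sum_{k=1}^\infty\frac{s_i^k+(s_i^*)^k}{4k^2-1}\Bigr)$$ (which in $C(\mathbb{T}^n)$ is the Fourier series of $\tfrac12(2-s_i-s_i^*)^{1/2}=|\sin(\pi\theta_i)|$) converges in the norm of $\mathcal{B}$. Then: 1. $\mathcal{B}$ is spectral (inverse-closed) in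 $C(\mathbb{T}^n)$: an element of $\mathcal{B}$ is invertible in $\mathcal{B}$ if and only if its image is invertible in $C(\mathbb{T}^n)$. 2. The inclusion induces isomorphisms in K-theory: $\iota_*:K_0(\mathcal{B})\to K_0(C(\mathbb{T}^n))$ and $\iota_*:K_1(\mathcal{B})\to K_1(C(\mathbb{T}^n))$ are group isomorphisms. Here $K_0(A)$ is the Grothendieck group of the monoid of idempotent matrices over $A$ up to Murray–von Neumann equivalence ($e=xy$, $f=yx$) under block sum, and $K_1(A)=\varinjlim_m GL_m(A)/GL_m(A)_0$, with $GL_m(A)_0$ the connected component of the identity and transition maps $u\mapsto u\oplus 1$. -/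

import Mathlib

namespace BanachKTheory

/-! ### `K₀`: idempotent matrices up to Murray-von Neumann equivalence -/

section KZero

variable {A B : Type*} [Ring A] [Ring B]

/-- (Algebraic) Murray-von Neumann equivalence of square matrices over `A`, of possibly
different sizes: `e = x y` and `f = y x` for some rectangular matrices `x` and `y`. -/
def MvN {m n : Type*} [Fintype m] [Fintype n] (e : Matrix m m A) (f : Matrix n n A) : Prop :=
  ∃ (x : Matrix m n A) (y : Matrix n m A), x * y = e ∧ y * x = f

theorem MvN.refl {m : Type*} [Fintype m] {e : Matrix m m A} (he : IsIdempotentElem e) :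
    MvN e e := ⟨e, e, he, he⟩

theorem MvN.symm {m n : Type*} [Fintype m] [Fintype n] {e : Matrix m m A} {f : Matrix n n A}
    (h : MvN e f) : MvN f e := by
  obtain ⟨x, y, h1, h2⟩ := h
  exact ⟨y, x, h2, h1⟩

theorem MvN.trans {m n p : Type*} [Fintype m] [Fintype n] [Fintype p]
    {e : Matrix m m A} {f : Matrix n n A} {g : Matrix p p A}
    (he : IsIdempotentElem e) (hg : IsIdempotentElem g) (h : MvN e f) (h' : MvN f g) :
    MvN e g := by
  obtain ⟨x, y, h1, h2⟩ := h
  obtain ⟨z, w, h3, h4⟩ := h'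
  refine ⟨x * z, w * y, ?_, ?_⟩
  · calc x * z * (w * y) = x * (z * w) * y := by simp only [Matrix.mul_assoc]
      _ = x * (y * x) * y := by rw [h3, h2]
      _ = (x * y) * (x * y) := by simp only [Matrix.mul_assoc]
      _ = e := by rw [h1]; exact he
  · calc w * y * (x * z) = w * (y * x) * z := by simp only [Matrix.mul_assoc]
      _ = w * (z * w) * z := by rw [h3, h2]
      _ = (w * z) * (w * z) := by simp only [Matrix.mul_assoc]
      _ = g := by rw [h4]; exact hg

theorem MvN.submatrix {m n : Type*} [Fintype m] [Fintype n] {e : Matrix m m A}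
    (he : IsIdempotentElem e) (σ : n ≃ m) : MvN e (e.submatrix σ σ) := by
  refine ⟨e.submatrix id σ, e.submatrix σ id, ?_, ?_⟩
  · rw [Matrix.submatrix_mul_equiv, he.eq, Matrix.submatrix_id_id]
  · rw [← Matrix.submatrix_mul _ _ _ _ _ Function.bijective_id, he.eq]

theorem isIdempotentElem_submatrix {m n : Type*} [Fintype m] [Fintype n] {e : Matrix m m A}
    (he : IsIdempotentElem e) (σ : n ≃ m) : IsIdempotentElem (e.submatrix σ σ) := by
  rw [IsIdempotentElem, Matrix.submatrix_mul_equiv, he.eq]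

theorem isIdempotentElem_fromBlocks {m n : Type*} [Fintype m] [Fintype n]
    {e : Matrix m m A} {f : Matrix n n A} (he : IsIdempotentElem e) (hf : IsIdempotentElem f) :
    IsIdempotentElem (Matrix.fromBlocks e 0 0 f) := by
  simp [IsIdempotentElem, Matrix.fromBlocks_multiply, he.eq, hf.eq]

theorem MvN.fromBlocks {m n m' n' : Type*} [Fintype m] [Fintype n] [Fintype m'] [Fintype n']
    {e : Matrix m m A} {f : Matrix n n A} {e' : Matrix m' m' A} {f' : Matrix n' n' A}
    (h : MvN e e') (h' : MvN f f') :
    MvN (Matrix.fromBlocks e 0 0 f) (Matrix.fromBlocks e' 0 0 f') := by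
  obtain ⟨x, y, h1, h2⟩ := h
  obtain ⟨z, w, h3, h4⟩ := h'
  exact ⟨Matrix.fromBlocks x 0 0 z, Matrix.fromBlocks y 0 0 w,
    by simp [Matrix.fromBlocks_multiply, h1, h3], by simp [Matrix.fromBlocks_multiply, h2, h4]⟩

variable (A) in
/-- Idempotent square matrices over `A`, of arbitrary finite size. -/
abbrev Idem : Type _ := Σ n : ℕ, {e : Matrix (Fin n) (Fin n) A // IsIdempotentElem e}

/-- The block sum `e ⊕ f` of two idempotent matrices. -/
def Idem.add (e f : Idem A) : Idem A :=
  ⟨e.1 + f.1, (Matrix.fromBlocks e.2.1 0 0 f.2.1).submatrix finSumFinEquiv.symm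
    finSumFinEquiv.symm,
    isIdempotentElem_submatrix (isIdempotentElem_fromBlocks e.2.2 f.2.2) _⟩

theorem Idem.add_mvN (e f : Idem A) :
    MvN (Matrix.fromBlocks e.2.1 0 0 f.2.1) (e.add f).2.1 :=
  MvN.submatrix (isIdempotentElem_fromBlocks e.2.2 f.2.2) _

variable (A) in
/-- Murray-von Neumann equivalence on idempotent matrices of arbitrary size. -/
abbrev Idem.setoid : Setoid (Idem A) where
  r e f := MvN e.2.1 f.2.1
  iseqv := ⟨fun e => MvN.refl e.2.2, fun h => h.symm,
    fun {e _ g} h h' => MvN.trans e.2.2 g.2.2 h h'⟩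

variable (A) in
/-- The monoid `V(A)` of classes of idempotent matrices over `A`. -/
def V : Type _ := Quotient (Idem.setoid A)

/-- The class in `V(A)` of an idempotent matrix. -/
def V.mk (e : Idem A) : V A := Quotient.mk (Idem.setoid A) e

theorem V.sound {e f : Idem A} (h : MvN e.2.1 f.2.1) : V.mk e = V.mk f :=
  Quotient.sound (s := Idem.setoid A) h

/-- Addition in `V(A)` is the block sum. -/
instance : Add (V A) where
  add := Quotient.map₂ (sa := Idem.setoid A) (sb := Idem.setoid A) (sc := Idem.setoid A) Idem.add
    (fun e e' h f f' h' =>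
      MvN.trans (e.add f).2.2 (e'.add f').2.2 (e.add_mvN f).symm
        (MvN.trans (isIdempotentElem_fromBlocks e.2.2 f.2.2) (e'.add f').2.2
          (MvN.fromBlocks h h') (e'.add_mvN f')))

/-- The zero of `V(A)` is the class of the empty matrix. -/
instance : Zero (V A) := ⟨V.mk ⟨0, 0, IsIdempotentElem.zero⟩⟩

theorem V.mk_add (e f : Idem A) : V.mk e + V.mk f = V.mk (e.add f) := rfl

theorem V.mk_add_eq {e f g : Idem A} (h : MvN (Matrix.fromBlocks e.2.1 0 0 f.2.1) g.2.1) :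
    V.mk e + V.mk f = V.mk g :=
  V.sound (MvN.trans (e.add f).2.2 g.2.2 (e.add_mvN f).symm h)

theorem V.add_comm' (a b : V A) : a + b = b + a := by
  refine Quotient.inductionOn₂ (s₁ := Idem.setoid A) (s₂ := Idem.setoid A) a b fun e f => ?_
  refine V.mk_add_eq (g := f.add e) ?_
  refine MvN.trans (isIdempotentElem_fromBlocks e.2.2 f.2.2) (f.add e).2.2 ?_ (f.add_mvN e)
  have h := MvN.submatrix (isIdempotentElem_fromBlocks e.2.2 f.2.2) (Equiv.sumComm _ _)
  simpa using h

theorem V.zero_add' (a : V A) : 0 + a = a := by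
  refine Quotient.inductionOn (s := Idem.setoid A) a fun e => ?_
  refine V.mk_add_eq (e := ⟨0, 0, IsIdempotentElem.zero⟩) (g := e) ?_
  have h := MvN.submatrix (isIdempotentElem_fromBlocks
    (IsIdempotentElem.zero (M₀ := Matrix (Fin 0) (Fin 0) A)) e.2.2) (Equiv.emptySum (Fin 0) _).symm
  convert h using 1
  ext i j
  rfl

theorem V.add_assoc' (a b c : V A) : a + b + c = a + (b + c) := by
  refine Quotient.inductionOn₃ (s₁ := Idem.setoid A) (s₂ := Idem.setoid A)
    (s₃ := Idem.setoid A) a b c fun e f g => ?_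
  refine V.mk_add_eq (e := e.add f) (f := g) (g := e.add (f.add g)) ?_
  have i1 := isIdempotentElem_fromBlocks (isIdempotentElem_fromBlocks e.2.2 f.2.2) g.2.2
  have h1 := MvN.fromBlocks (e.add_mvN f) (MvN.refl g.2.2)
  have h2 := MvN.fromBlocks (MvN.refl e.2.2) (f.add_mvN g)
  have h3 := MvN.submatrix i1 (Equiv.sumAssoc _ _ _).symm
  have h4 : (Matrix.fromBlocks (Matrix.fromBlocks e.2.1 0 0 f.2.1) 0 0 g.2.1).submatrix
      (Equiv.sumAssoc _ _ _).symm (Equiv.sumAssoc _ _ _).symm =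
      Matrix.fromBlocks e.2.1 0 0 (Matrix.fromBlocks f.2.1 0 0 g.2.1) := by
    ext i j
    rcases i with i | i | i <;> rcases j with j | j | j <;> rfl
  rw [h4] at h3
  refine MvN.trans (isIdempotentElem_fromBlocks (e.add f).2.2 g.2.2) (e.add (f.add g)).2.2
    h1.symm ?_
  refine MvN.trans i1 (e.add (f.add g)).2.2 h3 ?_
  exact MvN.trans (isIdempotentElem_fromBlocks e.2.2 (isIdempotentElem_fromBlocks f.2.2 g.2.2))
    (e.add (f.add g)).2.2 h2 (e.add_mvN (f.add g))

instance : AddCommMonoid (V A) where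
  add_assoc := V.add_assoc'
  zero_add := V.zero_add'
  add_zero a := by rw [V.add_comm', V.zero_add']
  add_comm := V.add_comm'
  nsmul := nsmulRec

/-- Entrywise application of a ring homomorphism to an idempotent matrix. -/
def Idem.map (φ : A →+* B) (e : Idem A) : Idem B :=
  ⟨e.1, φ.mapMatrix e.2.1, e.2.2.map φ.mapMatrix⟩

/-- The map `V(A) → V(B)` induced by a ring homomorphism. -/
def V.map (φ : A →+* B) : V A →+ V B where
  toFun := Quotient.map (sa := Idem.setoid A) (sb := Idem.setoid B) (Idem.map φ) (by
    rintro e f ⟨x, y, h1, h2⟩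
    exact ⟨x.map φ, y.map φ, Matrix.map_mul.symm.trans (congrArg (fun M => Matrix.map M φ) h1),
      Matrix.map_mul.symm.trans (congrArg (fun M => Matrix.map M φ) h2)⟩)
  map_zero' := V.sound (e := Idem.map φ ⟨0, 0, IsIdempotentElem.zero⟩)
    (f := ⟨0, 0, IsIdempotentElem.zero⟩) ⟨0, 0, by ext i; exact i.elim0, by ext i; exact i.elim0⟩
  map_add' a b := by
    refine Quotient.inductionOn₂ (s₁ := Idem.setoid A) (s₂ := Idem.setoid A) a b fun e f => ?_
    change V.mk ((e.add f).map φ) = V.mk ((e.map φ).add (f.map φ))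
    congr 1
    refine Sigma.ext rfl (heq_of_eq (Subtype.ext ?_))
    have h : (Matrix.fromBlocks e.2.1 0 0 f.2.1).map φ =
        Matrix.fromBlocks (e.2.1.map φ) 0 0 (f.2.1.map φ) := by
      simp [Matrix.fromBlocks_map]
    exact congrArg (fun M => Matrix.submatrix M finSumFinEquiv.symm finSumFinEquiv.symm) h

variable (A) in
/-- `K₀(A)`, the Grothendieck group of the monoid `V(A)`. -/
abbrev K0 : Type _ := Algebra.GrothendieckAddGroup (V A)

/-- The homomorphism `K₀(A) → K₀(B)` induced by a ring homomorphism. -/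
noncomputable def K0.map (φ : A →+* B) : K0 A →+ K0 B :=
  Algebra.GrothendieckAddGroup.lift (Algebra.GrothendieckAddGroup.of.comp (V.map φ))

end KZero

/-! ### `K₁`: connected components of the stable general linear group -/

section KOne

variable {A B : Type*} [Ring A] [Ring B]

variable (A) in
/-- The inclusion `A^m → A^n` of the first `m` coordinates, as an `n × m` matrix. -/
def incl {m n : ℕ} (h : m ≤ n) : Matrix (Fin n) (Fin m) A :=
  (1 : Matrix (Fin n) (Fin n) A).submatrix id (Fin.castLE h)

variable (A) in
/-- The projection `A^n → A^m` onto the first `m` coordinates, as an `m × n` matrix. -/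
def proj {m n : ℕ} (h : m ≤ n) : Matrix (Fin m) (Fin n) A :=
  (1 : Matrix (Fin n) (Fin n) A).submatrix (Fin.castLE h) id

theorem proj_mul_incl {m n : ℕ} (h : m ≤ n) : proj A h * incl A h = 1 := by
  rw [proj, incl, ← Matrix.submatrix_mul _ _ _ _ _ Function.bijective_id, Matrix.mul_one,
    Matrix.submatrix_one _ (Fin.castLE_injective h)]

theorem incl_mul_incl {m n p : ℕ} (h : m ≤ n) (h' : n ≤ p) :
    incl A h' * incl A h = incl A (h.trans h') := by
  ext i j
  simp [incl, Matrix.mul_apply, Matrix.one_apply]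

theorem proj_mul_proj {m n p : ℕ} (h : m ≤ n) (h' : n ≤ p) :
    proj A h * proj A h' = proj A (h.trans h') := by
  ext i j
  rw [Matrix.mul_apply, Finset.sum_eq_single (Fin.castLE h i)]
  · simp [proj, Matrix.one_apply]
  · intro k _ hk
    simp [proj, Matrix.one_apply, hk.symm]
  · simp

theorem incl_self (n : ℕ) : incl A (le_refl n) = 1 := rfl

theorem proj_self (n : ℕ) : proj A (le_refl n) = 1 := rfl

variable (A) in
/-- Stabilization `u ↦ u ⊕ 1` from `m × m` to `n × n` matrices, for `m ≤ n`: `u` is put in the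
upper left corner and the identity matrix in the lower right one. -/
def stabMat {m n : ℕ} (h : m ≤ n) : Matrix (Fin m) (Fin m) A →* Matrix (Fin n) (Fin n) A where
  toFun u := incl A h * u * proj A h + (1 - incl A h * proj A h)
  map_one' := by simp
  map_mul' u v := by
    have k1 : ∀ (x : Matrix (Fin m) (Fin n) A), proj A h * (incl A h * x) = x := fun x => by
      rw [← Matrix.mul_assoc, proj_mul_incl, Matrix.one_mul]
    simp only [mul_add, add_mul, mul_sub, sub_mul, mul_one, one_mul, Matrix.mul_assoc, k1]
    abel

theorem stabMat_apply {m n : ℕ} (h : m ≤ n) (u : Matrix (Fin m) (Fin m) A) :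
    stabMat A h u = incl A h * u * proj A h + (1 - incl A h * proj A h) := rfl

theorem stabMat_self {n : ℕ} (u : Matrix (Fin n) (Fin n) A) : stabMat A (le_refl n) u = u := by
  simp [stabMat_apply, incl_self, proj_self]

theorem stabMat_stabMat {m n p : ℕ} (h : m ≤ n) (h' : n ≤ p) (u : Matrix (Fin m) (Fin m) A) :
    stabMat A h' (stabMat A h u) = stabMat A (h.trans h') u := by
  have k2 : ∀ (x : Matrix (Fin m) (Fin p) A),
      incl A h' * (incl A h * x) = incl A (h.trans h') * x := fun x => by
    rw [← Matrix.mul_assoc, incl_mul_incl]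
  simp only [stabMat_apply, Matrix.mul_add, Matrix.add_mul, Matrix.mul_sub, Matrix.sub_mul,
    Matrix.mul_one, Matrix.mul_assoc, proj_mul_proj, k2]
  abel

theorem map_stabMat (φ : A →+* B) {m n : ℕ} (h : m ≤ n) (u : Matrix (Fin m) (Fin m) A) :
    φ.mapMatrix (stabMat A h u) = stabMat B h (φ.mapMatrix u) := by
  have h1 : (incl A h).map φ = incl B h := by
    ext i j; simp [incl, Matrix.one_apply, apply_ite φ]
  have h2 : (proj A h).map φ = proj B h := by
    ext i j; simp [proj, Matrix.one_apply, apply_ite φ]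
  rw [stabMat_apply, stabMat_apply, map_add, map_sub, map_one]
  simp only [RingHom.mapMatrix_apply, Matrix.map_mul, h1, h2]

/-- Entrywise application of a ring homomorphism to an invertible matrix. -/
def GLmap (φ : A →+* B) (n : ℕ) :
    Matrix.GeneralLinearGroup (Fin n) A →* Matrix.GeneralLinearGroup (Fin n) B :=
  Units.map (φ.mapMatrix : Matrix (Fin n) (Fin n) A →+* Matrix (Fin n) (Fin n) B).toMonoidHom

variable (A) in
/-- Stabilization `u ↦ u ⊕ 1` from `GL_m(A)` to `GL_n(A)`, for `m ≤ n`. -/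
def stab {m n : ℕ} (h : m ≤ n) :
    Matrix.GeneralLinearGroup (Fin m) A →* Matrix.GeneralLinearGroup (Fin n) A :=
  Units.map (stabMat A h)

theorem continuous_GLmap [TopologicalSpace A] [TopologicalSpace B] (φ : A →+* B) (hφ : Continuous φ)
    (n : ℕ) : Continuous (GLmap φ n) :=
  Continuous.units_map _ (continuous_id.matrix_map hφ)

variable [TopologicalSpace A] [IsTopologicalRing A] [TopologicalSpace B] [IsTopologicalRing B]

variable (A) in
/-- `GL_n(A)₀`, the connected component of the identity in `GL_n(A)`. For a Banach algebra `A`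
the group `GL_n(A)` is locally path connected, so that this is also the path component. -/
abbrev GL0 (n : ℕ) : Subgroup (Matrix.GeneralLinearGroup (Fin n) A) :=
  Subgroup.connectedComponentOfOne (Matrix.GeneralLinearGroup (Fin n) A)

/-- A continuous homomorphism of topological groups respects identity components. -/
theorem connectedComponentOfOne_le_comap {G H : Type*} [Group G] [TopologicalSpace G]
    [IsTopologicalGroup G] [Group H] [TopologicalSpace H] [IsTopologicalGroup H]
    (f : G →* H) (hf : Continuous f) :
    Subgroup.connectedComponentOfOne G ≤ (Subgroup.connectedComponentOfOne H).comap f := by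
  intro g hg
  have h := hf.image_connectedComponent_subset 1 ⟨g, hg, rfl⟩
  rw [map_one] at h
  exact h

instance (n : ℕ) : (GL0 A n).Normal where
  conj_mem g hg x :=
    connectedComponentOfOne_le_comap (MulAut.conj x).toMonoidHom
      (by change Continuous fun y => x * y * x⁻¹; fun_prop) hg

theorem continuous_stab {m n : ℕ} (h : m ≤ n) : Continuous (stab A h) :=
  Continuous.units_map _ (by
    change Continuous fun u : Matrix (Fin m) (Fin m) A =>
      incl A h * u * proj A h + (1 - incl A h * proj A h)
    fun_prop)

variable (A) in
/-- The map `GL_m(A)/GL_m(A)₀ → GL_n(A)/GL_n(A)₀` induced by `u ↦ u ⊕ 1`. -/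
def stabQuot (m n : ℕ) (h : m ≤ n) :
    Matrix.GeneralLinearGroup (Fin m) A ⧸ GL0 A m →*
      Matrix.GeneralLinearGroup (Fin n) A ⧸ GL0 A n :=
  QuotientGroup.map _ _ (stab A h) (connectedComponentOfOne_le_comap _ (continuous_stab h))

instance : DirectedSystem (fun n : ℕ => Matrix.GeneralLinearGroup (Fin n) A ⧸ GL0 A n)
    (stabQuot A · · ·) where
  map_self _ x := by
    induction x using QuotientGroup.induction_on with
    | H u => exact congrArg _ (Units.ext (stabMat_self _))
  map_map _ _ _ h h' x := by
    induction x using QuotientGroup.induction_on with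
    | H u => exact congrArg _ (Units.ext (stabMat_stabMat h h' _))

variable (A) in
/-- `K₁(A)`, the direct limit of the groups `GL_n(A)/GL_n(A)₀` along `u ↦ u ⊕ 1`. -/
abbrev K1 : Type _ :=
  DirectLimit (fun n : ℕ => Matrix.GeneralLinearGroup (Fin n) A ⧸ GL0 A n) (stabQuot A)

/-- The homomorphism `GL_n(A)/GL_n(A)₀ → GL_n(B)/GL_n(B)₀` induced by a continuous ring
homomorphism. -/
def GLquotMap (φ : A →+* B) (hφ : Continuous φ) (n : ℕ) :
    Matrix.GeneralLinearGroup (Fin n) A ⧸ GL0 A n →*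
      Matrix.GeneralLinearGroup (Fin n) B ⧸ GL0 B n :=
  QuotientGroup.map _ _ (GLmap φ n) (connectedComponentOfOne_le_comap _ (continuous_GLmap φ hφ n))

theorem GLquotMap_stabQuot (φ : A →+* B) (hφ : Continuous φ) (m n : ℕ) (h : m ≤ n)
    (x : Matrix.GeneralLinearGroup (Fin m) A ⧸ GL0 A m) :
    stabQuot B m n h (GLquotMap φ hφ m x) = GLquotMap φ hφ n (stabQuot A m n h x) := by
  induction x using QuotientGroup.induction_on with
  | H u => exact congrArg _ (Units.ext (map_stabMat φ h _).symm)

/-- The homomorphism `K₁(A) → K₁(B)` induced by a continuous ring homomorphism. -/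
noncomputable def K1.map (φ : A →+* B) (hφ : Continuous φ) : K1 A →* K1 B where
  toFun := DirectLimit.map _ _ (fun n => GLquotMap φ hφ n) (GLquotMap_stabQuot φ hφ)
  map_one' := by
    rw [DirectLimit.one_def (f := stabQuot A) 0, DirectLimit.one_def (f := stabQuot B) 0,
      DirectLimit.map_def]
    simp
  map_mul' x y := by
    induction x, y using DirectLimit.induction₂ with
    | ih n x y => simp only [DirectLimit.mul_def, DirectLimit.map_def, map_mul]

end KOne

end BanachKTheory

/-! Inverse-closedness is a statement about characters. The algebra `B` is commutative because it
injects into a function algebra, so a non-invertible `b` is killed by some character χ. With z =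
χ(s_i), χ turns the convergent series into a scalar one with terms (z^k + z^(-k)) / (4k² - 1). These
tend to zero, which excludes exponential growth of z^k and of z^(-k), so |z| = 1
(`norm_eq_one_of_tendsto_series`). Hence χ is evaluation at a point of the torus on ℂ[ℤⁿ]
(`exists_torus_point`), and by density on `B`; so ι(b) vanishes there.

The K-theory uses only that ι is continuous, has dense range and reflects invertibility. These
properties pass to matrix algebras, the last one through determinants. For K₀, an element of the
dense subalgebra near an idempotent is corrected to an idempotent by means of (1 + y)^(-1/2)
(`exists_idempotent_lift`), and an equivalence between images is approximated and corrected
(`MvN.of_map`). For K₁, the image of the unit group meets every coset of the identity component, and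
the identity component pulls back to the identity component
(`mem_connectedComponentOfOne_of_map_mem`). Throughout, smallness is available only in the target;
what is carried back is invertibility, hence spectral information. -/

open Filter Topology
open scoped ENNReal NNReal

/-! ### Power series in a Banach algebra; the inverse square root. -/

section PowerSeriesEval

variable {R S : Type*} [NormedRing R] [NormedAlgebra ℂ R] [NormedRing S] [NormedAlgebra ℂ S]

/-- The value of a power series with complex coefficients at an element of a Banach algebra. -/
noncomputable def psEval (f : PowerSeries ℂ) (y : R) : R := ∑' k, PowerSeries.coeff k f • y ^ k

/-- The coefficients of a power series are bounded. -/
def BoundedCoeff (f : PowerSeries ℂ) : Prop := ∃ C : ℝ, ∀ k, ‖PowerSeries.coeff k f‖ ≤ C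

theorem BoundedCoeff.summable_norm {f : PowerSeries ℂ} (hf : BoundedCoeff f) {y : R}
    (hy : Summable fun k : ℕ => ‖y ^ k‖) :
    Summable fun k => ‖PowerSeries.coeff k f • y ^ k‖ := by
  obtain ⟨C, hC⟩ := hf
  refine Summable.of_nonneg_of_le (fun _ => norm_nonneg _) (fun k => ?_) (hy.mul_left C)
  rw [norm_smul]
  exact mul_le_mul_of_nonneg_right (hC k) (norm_nonneg _)

theorem psEval_one (y : R) : psEval 1 y = 1 := by
  rw [psEval, tsum_eq_single 0]
  · simp
  · intro k hk
    simp [PowerSeries.coeff_one, hk]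

theorem psEval_one_add_X (y : R) : psEval (1 + PowerSeries.X) y = 1 + y := by
  rw [psEval, tsum_eq_sum (s := Finset.range 2)]
  · simp [Finset.sum_range_succ, PowerSeries.coeff_one, PowerSeries.coeff_X]
  · intro k hk
    have hk : 1 < k := by simpa using hk
    simp [PowerSeries.coeff_one, PowerSeries.coeff_X, show k ≠ 0 by lia, show k ≠ 1 by lia]

variable [CompleteSpace R]

theorem psEval_mul {f g : PowerSeries ℂ} (hf : BoundedCoeff f) (hg : BoundedCoeff g) {y : R}
    (hy : Summable fun k : ℕ => ‖y ^ k‖) : psEval (f * g) y = psEval f y * psEval g y := by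
  rw [psEval, psEval, psEval, tsum_mul_tsum_eq_tsum_sum_antidiagonal_of_summable_norm
    (hf.summable_norm hy) (hg.summable_norm hy)]
  refine tsum_congr fun n => ?_
  rw [PowerSeries.coeff_mul, Finset.sum_smul]
  refine Finset.sum_congr rfl fun p hp => ?_
  rw [smul_mul_smul_comm, ← pow_add, (Finset.HasAntidiagonal.mem_antidiagonal.1 hp :)]

theorem Commute.psEval_right {f : PowerSeries ℂ} {a y : R} (hf : BoundedCoeff f)
    (hy : Summable fun k : ℕ => ‖y ^ k‖) (h : Commute a y) : Commute a (psEval f y) := by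
  have hs := (hf.summable_norm hy).of_norm
  rw [Commute, SemiconjBy, psEval, ← hs.tsum_mul_left, ← hs.tsum_mul_right]
  exact tsum_congr fun k => ((h.pow_right k).smul_right _).eq

theorem map_psEval {f : PowerSeries ℂ} (hf : BoundedCoeff f) {y : R}
    (hy : Summable fun k : ℕ => ‖y ^ k‖) (φ : R →ₐ[ℂ] S) (hφ : Continuous φ) :
    φ (psEval f y) = psEval f (φ y) := by
  have hs := (hf.summable_norm hy).of_norm
  rw [psEval, hs.map_tsum φ hφ]
  simp [psEval]

/-- The binomial series of `(1 + X) ^ (-1/2)`. -/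
noncomputable def invSqrtSeries : PowerSeries ℂ := PowerSeries.binomialSeries ℂ (-1 / 2 : ℚ)

/-- Consecutive coefficients have ratio (-1/2 - k) / (k + 1), of absolute value at most 1. -/
theorem norm_coeff_invSqrtSeries_le (k : ℕ) : ‖PowerSeries.coeff k invSqrtSeries‖ ≤ 1 := by
  have h : |Ring.choose (-1 / 2 : ℚ) k| ≤ 1 := by
    induction k with
    | zero => simp
    | succ k ih =>
      have h1 : Ring.choose (-1 / 2 : ℚ) (k + 1) * (k + 1) =
          Ring.choose (-1 / 2 : ℚ) k * (-1 / 2 - k) := by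
        have h := Ring.choose_smul_choose (-1 / 2 : ℚ) k.le_succ
        simp only [Nat.succ_eq_add_one, Nat.choose_succ_self_right, add_tsub_cancel_left,
          Ring.choose_one_right, nsmul_eq_mul] at h
        rw [mul_comm, ← h]
        push_cast
        rfl
      have h2 : Ring.choose (-1 / 2 : ℚ) (k + 1) =
          Ring.choose (-1 / 2 : ℚ) k * ((-1 / 2 - k) / (k + 1)) := by
        field_simp at h1 ⊢
        linarith
      have h3 : |(-1 / 2 - k : ℚ) / (k + 1)| ≤ 1 := by
        rw [abs_div, abs_of_pos (by positivity : (0 : ℚ) < k + 1), div_le_one (by positivity),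
          abs_le]
        constructor <;> linarith [(Nat.cast_nonneg k : (0 : ℚ) ≤ k)]
      rw [h2, abs_mul]
      exact mul_le_one₀ ih (abs_nonneg _) h3
  rw [invSqrtSeries, PowerSeries.binomialSeries_coeff, Rat.smul_one_eq_cast]
  rw [Complex.norm_ratCast]
  exact_mod_cast h

theorem boundedCoeff_invSqrtSeries : BoundedCoeff invSqrtSeries :=
  ⟨1, norm_coeff_invSqrtSeries_le⟩

theorem invSqrtSeries_mul_mul : invSqrtSeries * (invSqrtSeries * (1 + PowerSeries.X)) = 1 := by
  have h : (1 + PowerSeries.X : PowerSeries ℂ) = PowerSeries.binomialSeries ℂ (1 : ℚ) := by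
    simpa using (PowerSeries.binomialSeries_nat (R := ℚ) (A := ℂ) 1).symm
  rw [h, invSqrtSeries, ← PowerSeries.binomialSeries_add, ← PowerSeries.binomialSeries_add]
  norm_num

theorem boundedCoeff_one_add_X : BoundedCoeff (1 + PowerSeries.X) := by
  refine ⟨2, fun k => ?_⟩
  rw [map_add, PowerSeries.coeff_one, PowerSeries.coeff_X]
  refine (norm_add_le _ _).trans ?_
  split_ifs <;> norm_num

theorem BoundedCoeff.mul_one_add_X {f : PowerSeries ℂ} (hf : BoundedCoeff f) :
    BoundedCoeff (f * (1 + PowerSeries.X)) := by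
  obtain ⟨C, hC⟩ := hf
  refine ⟨C + C, fun k => ?_⟩
  rw [mul_add, mul_one, map_add]
  refine (norm_add_le _ _).trans (add_le_add (hC k) ?_)
  cases k with
  | zero => simpa using (norm_nonneg _).trans (hC 0)
  | succ k => simpa [PowerSeries.coeff_succ_mul_X] using hC k

theorem psEval_invSqrtSeries_mul_mul {y : R} (hy : Summable fun k : ℕ => ‖y ^ k‖) :
    psEval invSqrtSeries y * (psEval invSqrtSeries y * (1 + y)) = 1 := by
  have h := boundedCoeff_invSqrtSeries
  rw [← psEval_one_add_X, ← psEval_mul h boundedCoeff_one_add_X hy,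
    ← psEval_mul h h.mul_one_add_X hy, invSqrtSeries_mul_mul, psEval_one]

theorem norm_psEval_invSqrtSeries_sub_one_le {y : R} (hy : ‖y‖ < 1) :
    ‖psEval invSqrtSeries y - 1‖ ≤ ‖y‖ / (1 - ‖y‖) := by
  have hy' := summable_norm_geometric_of_norm_lt_one hy
  have hs := (boundedCoeff_invSqrtSeries.summable_norm hy').of_norm
  have h0 : psEval invSqrtSeries y - 1 =
      ∑' k, PowerSeries.coeff (k + 1) invSqrtSeries • y ^ (k + 1) := by
    rw [psEval, hs.tsum_eq_zero_add]
    simp [invSqrtSeries]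
  rw [h0, div_eq_mul_inv]
  refine tsum_of_norm_bounded ((hasSum_geometric_of_lt_one (norm_nonneg y) hy).mul_left ‖y‖)
    fun k => ?_
  rw [norm_smul, ← pow_succ']
  exact (mul_le_of_le_one_left (norm_nonneg _) (norm_coeff_invSqrtSeries_le _)).trans
    (norm_pow_le' y k.succ_pos)

/-- Gelfand's formula and the root test. This lets `psEval` be used at elements whose norm may be
large but whose spectrum is small. -/
theorem summable_norm_pow_of_spectralRadius_lt_one {y : R} (hy : spectralRadius ℂ y < 1) :
    Summable fun k : ℕ => ‖y ^ k‖ := by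
  obtain ⟨r, hr, hr1⟩ := ENNReal.lt_iff_exists_nnreal_btwn.1 hy
  have h := (spectrum.pow_nnnorm_pow_one_div_tendsto_nhds_spectralRadius y).eventually_lt_const hr
  have hr1 : (r : ℝ) < 1 := by exact_mod_cast hr1
  refine (summable_geometric_of_lt_one r.2 hr1).of_norm_bounded_eventually_nat ?_
  filter_upwards [h, eventually_gt_atTop 0] with k hk hk0
  have h2 := ENNReal.rpow_le_rpow hk.le (Nat.cast_nonneg k : (0 : ℝ) ≤ k)
  rw [← ENNReal.rpow_mul, one_div, inv_mul_cancel₀ (by positivity), ENNReal.rpow_one,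
    ENNReal.rpow_natCast] at h2
  rw [norm_norm]
  exact_mod_cast h2

theorem tendsto_psEval_invSqrtSeries :
    Tendsto (psEval invSqrtSeries : R → R) (𝓝 0) (𝓝 1) := by
  rw [tendsto_iff_norm_sub_tendsto_zero]
  have h : Tendsto (fun y : R => ‖y‖ / (1 - ‖y‖)) (𝓝 0) (𝓝 0) := by
    have h : ContinuousAt (fun y : R => ‖y‖ / (1 - ‖y‖)) 0 :=
      ContinuousAt.div (by fun_prop) (by fun_prop) (by simp)
    simpa [ContinuousAt] using h
  refine squeeze_zero' (Eventually.of_forall fun _ => norm_nonneg _) ?_ h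
  filter_upwards [Metric.ball_mem_nhds (0 : R) one_pos] with y hy
  exact norm_psEval_invSqrtSeries_sub_one_le (by simpa using hy)

end PowerSeriesEval

/-! ### Homomorphisms with dense range that reflect invertibility. -/

section DenseSpectral

theorem isOpen_norm_sub_one_lt {S : Type*} [NormedRing S] :
    IsOpen {u : Sˣ | ‖(u : S) - 1‖ < 1} :=
  isOpen_lt (by fun_prop) continuous_const

variable {R S : Type*} [NormedRing R] [NormedAlgebra ℂ R] [NormedRing S] [NormedAlgebra ℂ S]

theorem isIdempotentElem_half_one_add {s : R} (hs : s * s = 1) :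
    IsIdempotentElem ((1 / 2 : ℂ) • (1 + s)) := by
  have h : (1 + s) * (1 + s) = (2 : ℂ) • (1 + s) := by
    rw [two_smul]
    noncomm_ring
    rw [hs]
    abel
  rw [IsIdempotentElem, smul_mul_smul_comm, h, smul_smul]
  norm_num

variable [CompleteSpace S]

/-- The units of `S` are open in `S`, so density yields an element of `R` mapping into `U`; it is a
unit because φ reflects invertibility. -/
theorem exists_unit_map_mem (φ : R →ₐ[ℂ] S) (hd : DenseRange φ)
    (hu : ∀ r, IsUnit (φ r) → IsUnit r) {U : Set Sˣ} (hU : IsOpen U) (hne : U.Nonempty) :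
    ∃ g : Rˣ, Units.map (φ : R →* S) g ∈ U := by
  obtain ⟨r, u, hu', hr⟩ :=
    hd.exists_mem_open (Units.isOpenEmbedding_val.isOpenMap U hU) (hne.image _)
  refine ⟨(hu r (hr ▸ u.isUnit)).unit, ?_⟩
  convert hu'
  ext
  exact hr.symm

/-- A unit whose image is at distance less than one from the identity lies in the identity
component, provided the homomorphism reflects invertibility. -/
theorem mem_connectedComponent_one_of_norm_lt [CompleteSpace R] (φ : R →ₐ[ℂ] S)
    (hu : ∀ r, IsUnit (φ r) → IsUnit r) {g : Rˣ} (hg : ‖φ g - 1‖ < 1) :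
    g ∈ connectedComponent (1 : Rˣ) := by
  -- The segment from 1 to `g` consists of units: its image stays at distance less than 1 from 1 in
  -- `S`, even if the segment is long in `R`.
  let K : Set Rˣ := Units.val ⁻¹' segment ℝ (1 : R) g
  have hK : Units.val '' K = segment ℝ (1 : R) g := by
    rw [Set.image_preimage_eq_iff]
    intro x hx
    rw [segment_eq_image'] at hx
    obtain ⟨θ, ⟨h0, h1⟩, rfl⟩ := hx
    refine hu _ ?_
    have h : φ (1 + θ • ((g : R) - 1)) = 1 - (θ : ℂ) • (1 - φ g) := by
      rw [← Complex.coe_smul, map_add, map_smul, map_sub, map_one, ← neg_sub (1 : S), smul_neg,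
        ← sub_eq_add_neg]
    change IsUnit (φ (1 + θ • ((g : R) - 1)))
    rw [h]
    refine isUnit_one_sub_of_norm_lt_one ?_
    rw [norm_smul, norm_sub_rev, Complex.norm_real, Real.norm_eq_abs, abs_of_nonneg h0]
    exact (mul_le_of_le_one_left (norm_nonneg _) h1).trans_lt hg
  have hpre : IsPreconnected K := by
    rw [← Units.isOpenEmbedding_val.isInducing.isPreconnected_image, hK]
    exact (convex_segment _ _).isPreconnected
  exact hpre.subset_connectedComponent (x := 1) (left_mem_segment ℝ _ _) (right_mem_segment ℝ _ _)

theorem isOpen_connectedComponentOfOne_units :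
    IsOpen (Subgroup.connectedComponentOfOne Sˣ : Set Sˣ) := by
  refine Subgroup.isOpen_of_mem_nhds _ (g := 1) ?_
  filter_upwards [isOpen_norm_sub_one_lt.mem_nhds (by simp : (1 : Sˣ) ∈ _)] with u hu
  exact mem_connectedComponent_one_of_norm_lt (AlgHom.id ℂ S) (fun _ h => h) hu

/-- The map on unit groups induced by a homomorphism with dense range that reflects invertibility
meets every coset of the identity component. -/
theorem exists_unit_map_mul_mem (φ : R →ₐ[ℂ] S) (hd : DenseRange φ)
    (hu : ∀ r, IsUnit (φ r) → IsUnit r) (h : Sˣ) :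
    ∃ g : Rˣ, (Units.map (φ : R →* S) g)⁻¹ * h ∈ Subgroup.connectedComponentOfOne Sˣ :=
  exists_unit_map_mem φ hd hu (U := {x | x⁻¹ * h ∈ Subgroup.connectedComponentOfOne Sˣ})
    (isOpen_connectedComponentOfOne_units.preimage (by fun_prop)) ⟨h, by simp [one_mem]⟩

variable [CompleteSpace R]

/-- If the powers of `(2 r - 1) ^ 2 - 1` are summable, normalizing `2 r - 1` to an
involution gives an idempotent close to `r`. -/
theorem involution_of_summable_norm_pow {r : R}
    (hr : Summable fun k : ℕ => ‖((2 * r - 1) * (2 * r - 1) - 1) ^ k‖) :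
    ((2 * r - 1) * psEval invSqrtSeries ((2 * r - 1) * (2 * r - 1) - 1)) *
      ((2 * r - 1) * psEval invSqrtSeries ((2 * r - 1) * (2 * r - 1) - 1)) = 1 := by
  have h1 := psEval_invSqrtSeries_mul_mul hr
  have h2 : Commute (2 * r - 1) ((2 * r - 1) * (2 * r - 1) - 1) :=
    ((Commute.refl _).mul_right (Commute.refl _)).sub_right (Commute.one_right _)
  have h3 := h2.psEval_right boundedCoeff_invSqrtSeries hr
  set c := psEval invSqrtSeries ((2 * r - 1) * (2 * r - 1) - 1)
  rw [add_sub_cancel] at h1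
  refine Eq.trans ?_ h1
  generalize 2 * r - 1 = u at h3
  calc u * c * (u * c) = c * u * (c * u) := by rw [h3.eq]
    _ = c * (u * c) * u := by simp only [mul_assoc]
    _ = c * (c * u) * u := by rw [h3.eq]
    _ = c * (c * (u * u)) := by simp only [mul_assoc]

/-- Idempotents lift, up to conjugacy, along a continuous homomorphism of Banach algebras that has
dense range and reflects invertibility. -/
theorem exists_idempotent_lift (φ : R →ₐ[ℂ] S) (hφ : Continuous φ) (hd : DenseRange φ)
    (hu : ∀ r, IsUnit (φ r) → IsUnit r) {e : S} (he : IsIdempotentElem e) :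
    ∃ p : R, IsIdempotentElem p ∧ ∃ z : Sˣ, ↑z * e = φ p * z := by
  -- Idempotents correspond to involutions via t = 2e - 1, so it suffices to lift `t` up to
  -- conjugacy.
  set t := 2 * e - 1 with ht
  have htt : t * t = 1 := by
    rw [ht]; noncomm_ring; rw [he.eq]; abel
  let y : S → S := fun a => (2 * a - 1) * (2 * a - 1) - 1
  have hy : Continuous y := by fun_prop
  have hye : y e = 0 := sub_eq_zero.2 htt
  -- For involutions σ and t, the element 1 + σt intertwines them: (1 + σt)t = σ(1 + σt). It is
  -- invertible for a near e, since its limit is 1 + t² = 2.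
  have ev1 : ∀ᶠ a in 𝓝 e, IsUnit (1 + (2 * a - 1) * psEval invSqrtSeries (y a) * t) := by
    have h1 : Tendsto (fun a => psEval invSqrtSeries (y a)) (𝓝 e) (𝓝 1) :=
      tendsto_psEval_invSqrtSeries.comp (hye ▸ hy.tendsto e)
    have h2 : Tendsto (fun a => 1 + (2 * a - 1) * psEval invSqrtSeries (y a) * t) (𝓝 e)
        (𝓝 (1 + t * 1 * t)) := by
      refine (((Continuous.tendsto (by fun_prop) e).mul h1).mul_const t).const_add 1
    refine h2.eventually (Units.isOpen.mem_nhds ?_)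
    rw [mul_one, htt]
    have : IsUnit ((2 : ℂ) • (1 : S)) := by
      simpa [Algebra.algebraMap_eq_smul_one] using
        (isUnit_iff_ne_zero.2 (two_ne_zero : (2 : ℂ) ≠ 0)).map (algebraMap ℂ S)
    simpa [two_smul] using this
  -- The factor ‖1‖ comes from the bound on spectral values, as the norm of 1 is not assumed to be
  -- 1.
  have ev2 : ∀ᶠ a in 𝓝 e, ‖y a‖ * ‖(1 : S)‖ < 1 / 2 := by
    have h : Continuous fun a => ‖y a‖ * ‖(1 : S)‖ := by fun_prop
    exact h.tendsto e |>.eventually_lt_const (by simp [hye])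
  obtain ⟨_, ⟨h1, h2⟩, r, rfl⟩ := mem_closure_iff_nhds.1 (hd e) _ (ev1.and ev2)
  set yr := (2 * r - 1) * (2 * r - 1) - 1 with hyr
  have hφy : φ yr = y (φ r) := by simp [hyr, y, map_ofNat]
  -- The norm of `yr` in `R` is not controlled, but its spectrum lies in that of its image, where
  -- the norm bound applies.
  have hrad : spectralRadius ℂ yr < 1 := by
    refine lt_of_le_of_lt (b := ((1 / 2 : ℝ≥0) : ℝ≥0∞)) ?_ (by
      exact_mod_cast (by norm_num : (1 / 2 : ℝ≥0) < 1))
    refine iSup₂_le fun k hk => ?_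
    have hk' : k ∈ spectrum ℂ (y (φ r)) := by
      rw [← hφy]
      intro h
      refine hk (hu _ ?_)
      rw [spectrum.mem_resolventSet_iff] at h
      simpa using h
    have := (spectrum.norm_le_norm_mul_of_mem hk').trans h2.le
    exact_mod_cast (show (‖k‖₊ : ℝ) ≤ ((1 / 2 : ℝ≥0) : ℝ) by simpa using this)
  have hsum := summable_norm_pow_of_spectralRadius_lt_one hrad
  set s := (2 * r - 1) * psEval invSqrtSeries yr with hs
  have hss : s * s = 1 := involution_of_summable_norm_pow hsum
  have hφs : φ s = (2 * φ r - 1) * psEval invSqrtSeries (y (φ r)) := by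
    rw [hs, map_mul, map_psEval boundedCoeff_invSqrtSeries hsum φ hφ, hφy]
    simp [map_ofNat]
  rw [← hφs] at h1
  refine ⟨(1 / 2 : ℂ) • (1 + s), isIdempotentElem_half_one_add hss, h1.unit, ?_⟩
  have hσ : φ s * φ s = 1 := by rw [← map_mul, hss, map_one]
  have he2 : e = (1 / 2 : ℂ) • (1 + t) := by
    rw [ht, add_sub_cancel, two_mul, ← two_smul ℂ, smul_smul]
    norm_num
  rw [IsUnit.unit_spec, map_smul, map_add, map_one]
  nth_rewrite 1 [he2]
  rw [mul_smul_comm, smul_mul_assoc]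
  congr 1
  generalize φ s = σ at hσ
  have h1 : σ * (σ * t) = t := by rw [← mul_assoc, hσ, one_mul]
  have h2 : σ * t * t = σ := by rw [mul_assoc, htt, mul_one]
  simp only [mul_add, add_mul, mul_one, one_mul, h1, h2]
  abel

/-- A unit whose image lies in the identity component lies itself in the identity component. -/
theorem mem_connectedComponentOfOne_of_map_mem (φ : R →ₐ[ℂ] S)
    (hd : DenseRange φ) (hu : ∀ r, IsUnit (φ r) → IsUnit r) {g : Rˣ}
    (hg : Units.map (φ : R →* S) g ∈ Subgroup.connectedComponentOfOne Sˣ) :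
    g ∈ Subgroup.connectedComponentOfOne Rˣ := by
  let f : Rˣ →* Sˣ := Units.map (φ : R →* S)
  let C := Subgroup.connectedComponentOfOne Rˣ
  have small : ∀ x : Rˣ, ‖(f x : S) - 1‖ < 1 → x ∈ C :=
    fun x hx => mem_connectedComponent_one_of_norm_lt φ hu hx
  -- `H` contains the unit ball around 1, since units there are limits of images of units in `C`. It
  -- is thus a clopen subgroup and contains the identity component of `Sˣ`.
  let H := (C.map f).topologicalClosure
  have hH : IsOpen (H : Set Sˣ) := by
    refine Subgroup.isOpen_of_mem_nhds _ (g := 1) ?_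
    have h1 := isOpen_norm_sub_one_lt (S := S)
    filter_upwards [h1.mem_nhds (by simp : (1 : Sˣ) ∈ _)] with u hu'
    refine mem_closure_iff.2 fun U hU huU => ?_
    obtain ⟨x, hxU, hx⟩ := exists_unit_map_mem φ hd hu (hU.inter h1) ⟨u, huU, hu'⟩
    exact ⟨f x, hxU, x, small x hx, rfl⟩
  have hgH : f g ∈ H :=
    isPreconnected_connectedComponent.subset_isClopen ⟨isClosed_closure, hH⟩
      ⟨1, mem_connectedComponent, one_mem H⟩ hg
  have hO : IsOpen {h : Sˣ | ‖(((f g)⁻¹ * h : Sˣ) : S) - 1‖ < 1} :=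
    isOpen_norm_sub_one_lt.preimage (by fun_prop : Continuous fun h : Sˣ => (f g)⁻¹ * h)
  -- An `x` in `C` has image so close to that of `g` that `small` applies to g⁻¹x.
  obtain ⟨_, hh, x, hx, rfl⟩ := mem_closure_iff.1 hgH _ hO (by simp)
  have h2 : g⁻¹ * x ∈ C := small _ (by simpa using hh)
  simpa using C.mul_mem hx (C.inv_mem h2)

end DenseSpectral

/-! ### Transfer to K₀ and K₁. -/

namespace BanachKTheory

section Algebraic

variable {A B : Type*} [CommRing A] [CommRing B]

/-- For commutative rings, a homomorphism that reflects invertibility does so on matrices. -/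
theorem isUnit_of_isUnit_mapMatrix (φ : B →+* A) (hu : ∀ b, IsUnit (φ b) → IsUnit b) {n : Type*}
    [Fintype n] [DecidableEq n] (M : Matrix n n B) (h : IsUnit (φ.mapMatrix M)) : IsUnit M := by
  rw [Matrix.isUnit_iff_isUnit_det] at h ⊢
  rw [← RingHom.map_det] at h
  exact hu _ h

/-- The pair (a, c) is an equivalence up to the units u = ac + (1 - e) and v = ca + (1 - f). Since
ua = av, replacing c by cu⁻¹ makes it exact on both sides. -/
theorem MvN.of_isUnit {R : Type*} [Ring R] {m n : Type*} [Fintype m] [Fintype n] [DecidableEq m]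
    [DecidableEq n] {e : Matrix m m R} {f : Matrix n n R}
    (he : IsIdempotentElem e) (hf : IsIdempotentElem f) {a : Matrix m n R} {c : Matrix n m R} (hea : e * a = a) (haf : a * f = a) (hfc : f * c = c)
    (hu : IsUnit (a * c + (1 - e))) (hv : IsUnit (c * a + (1 - f))) :
    MvN e f := by
  obtain ⟨⟨u, u', huu', hu'u⟩, hu⟩ := hu
  obtain ⟨⟨v, v', hvv', hv'v⟩, hv⟩ := hv
  change u = _ at hu
  change v = _ at hv
  have h1 : e * u = a * c := by
    rw [hu, Matrix.mul_add, ← Matrix.mul_assoc, hea, Matrix.mul_sub, Matrix.mul_one, he.eq,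
      sub_self, add_zero]
  have h2 : f * v = c * a := by
    rw [hv, Matrix.mul_add, ← Matrix.mul_assoc, hfc, Matrix.mul_sub, Matrix.mul_one, hf.eq,
      sub_self, add_zero]
  have h3 : u * a = a * v := by
    rw [hu, hv, Matrix.add_mul, Matrix.mul_add, Matrix.sub_mul, Matrix.mul_sub, Matrix.one_mul,
      Matrix.mul_one, hea, haf, Matrix.mul_assoc, sub_self]
  have h4 : u' * a = a * v' := by
    calc u' * a = u' * (a * v) * v' := by
          rw [Matrix.mul_assoc, Matrix.mul_assoc, hvv', Matrix.mul_one]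
      _ = a * v' := by rw [← h3, ← Matrix.mul_assoc, hu'u, Matrix.one_mul]
  refine ⟨a, c * u', ?_, ?_⟩
  · rw [← Matrix.mul_assoc, ← h1, Matrix.mul_assoc, huu', Matrix.mul_one]
  · rw [Matrix.mul_assoc, h4, ← Matrix.mul_assoc, ← h2, Matrix.mul_assoc, hvv', Matrix.mul_one]

end Algebraic

section Dense

variable {A B : Type*} [NormedCommRing A] [CompleteSpace A] [CommRing B]

theorem denseRange_matrix_map {A B m n : Type*} [TopologicalSpace A] {φ : B → A}
    (hd : DenseRange φ) : DenseRange fun M : Matrix m n B => M.map φ :=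
  DenseRange.piMap fun _ => DenseRange.piMap fun _ => hd

theorem isOpen_isUnit_matrix {n : Type*} [Fintype n] [DecidableEq n] :
    IsOpen {M : Matrix n n A | IsUnit M} := by
  simp_rw [Matrix.isUnit_iff_isUnit_det]
  exact Units.isOpen.preimage (by fun_prop)

/-- The hypotheses of `MvN.of_isUnit` are open conditions on the pair of matrices, apart from the
corner relations, which compressing by e and f enforces. The pair realizing the equivalence over `A`
can therefore be replaced by one from `B`. -/
theorem MvN.of_map (φ : B →+* A) (hd : DenseRange φ) (hu : ∀ b, IsUnit (φ b) → IsUnit b)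
    {m n : Type*} [Fintype m] [Fintype n] [DecidableEq m] [DecidableEq n]
    {e : Matrix m m B} {f : Matrix n n B} (he : IsIdempotentElem e) (hf : IsIdempotentElem f)
    (h : MvN (e.map φ) (f.map φ)) : MvN e f := by
  obtain ⟨x, y, hxy, hyx⟩ := h
  set E := e.map φ with hE
  set F := f.map φ with hF
  have hEE : E * E = E := by rw [hE, ← Matrix.map_mul, he.eq]
  have hFF : F * F = F := by rw [hF, ← Matrix.map_mul, hf.eq]
  let U : Set (Matrix m n A × Matrix n m A) :=
    {p | IsUnit (E * p.1 * F * (F * p.2 * E) + (1 - E))} ∩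
      {p | IsUnit (F * p.2 * E * (E * p.1 * F) + (1 - F))}
  have hU : IsOpen U :=
    (isOpen_isUnit_matrix.preimage (by fun_prop)).inter (isOpen_isUnit_matrix.preimage (by fun_prop))
  have hne : (x, y) ∈ U := by
    have h1 : E * x * F * (F * y * E) = E := by
      calc E * x * F * (F * y * E) = E * x * (F * F) * y * E := by simp only [Matrix.mul_assoc]
        _ = E * (x * y) * (x * y) * E := by rw [hFF, ← hyx]; simp only [Matrix.mul_assoc]
        _ = E := by rw [hxy, hEE, hEE, hEE]
    have h2 : F * y * E * (E * x * F) = F := by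
      calc F * y * E * (E * x * F) = F * y * (E * E) * x * F := by simp only [Matrix.mul_assoc]
        _ = F * (y * x) * (y * x) * F := by rw [hEE, ← hxy]; simp only [Matrix.mul_assoc]
        _ = F := by rw [hyx, hFF, hFF, hFF]
    constructor
    · change IsUnit (E * x * F * (F * y * E) + (1 - E))
      simp [h1]
    · change IsUnit (F * y * E * (E * x * F) + (1 - F))
      simp [h2]
  obtain ⟨⟨a, c⟩, h1, h2⟩ :=
    ((denseRange_matrix_map hd).prodMap (denseRange_matrix_map hd)).exists_mem_open hU ⟨_, hne⟩
  refine MvN.of_isUnit he hf (a := e * a * f) (c := f * c * e) ?_ ?_ ?_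
    (isUnit_of_isUnit_mapMatrix φ hu _ ?_) (isUnit_of_isUnit_mapMatrix φ hu _ ?_)
  · rw [← Matrix.mul_assoc, ← Matrix.mul_assoc, he.eq]
  · rw [Matrix.mul_assoc, hf.eq]
  · rw [← Matrix.mul_assoc, ← Matrix.mul_assoc, hf.eq]
  · rw [map_add, map_sub, map_one]
    simpa [Matrix.map_mul] using h1
  · rw [map_add, map_sub, map_one]
    simpa [Matrix.map_mul] using h2

theorem V.map_injective (φ : B →+* A) (hd : DenseRange φ) (hu : ∀ b, IsUnit (φ b) → IsUnit b) :
    Function.Injective (V.map φ) := by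
  intro a b
  refine Quotient.inductionOn₂ (s₁ := Idem.setoid B) (s₂ := Idem.setoid B) a b fun e f h => ?_
  exact V.sound (MvN.of_map φ hd hu e.2.2 f.2.2 (Quotient.exact (s := Idem.setoid A) h))

end Dense

theorem K0.map_bijective_of_V {A B : Type*} [Ring A] [Ring B] (φ : B →+* A)
    (h : Function.Bijective (V.map φ)) : Function.Bijective (K0.map φ) := by
  let e := AddEquiv.ofBijective (V.map φ) h
  let ψ : K0 A →+ K0 B :=
    Algebra.GrothendieckAddGroup.lift (Algebra.GrothendieckAddGroup.of.comp e.symm.toAddMonoidHom)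
  have of_map (x : V B) : K0.map φ (Algebra.GrothendieckAddGroup.of x) =
      Algebra.GrothendieckAddGroup.of (e x) :=
    DFunLike.congr_fun (Algebra.GrothendieckAddGroup.lift.symm_apply_apply _) x
  have of_symm (x : V A) : ψ (Algebra.GrothendieckAddGroup.of x) =
      Algebra.GrothendieckAddGroup.of (e.symm x) :=
    DFunLike.congr_fun (Algebra.GrothendieckAddGroup.lift.symm_apply_apply _) x
  have h1 : ψ.comp (K0.map φ) = AddMonoidHom.id _ :=
    Algebra.GrothendieckAddGroup.lift.symm.injective <| by
      ext x
      change ψ (K0.map φ (Algebra.GrothendieckAddGroup.of x)) = Algebra.GrothendieckAddGroup.of x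
      rw [of_map, of_symm, e.symm_apply_apply]
  have h2 : (K0.map φ).comp ψ = AddMonoidHom.id _ :=
    Algebra.GrothendieckAddGroup.lift.symm.injective <| by
      ext x
      change K0.map φ (ψ (Algebra.GrothendieckAddGroup.of x)) = Algebra.GrothendieckAddGroup.of x
      rw [of_symm, of_map, e.apply_symm_apply]
  exact Function.bijective_iff_has_inverse.2 ⟨ψ, DFunLike.congr_fun h1, DFunLike.congr_fun h2⟩

theorem K1.map_bijective_of_GLquotMap {A B : Type*} [Ring A] [TopologicalSpace A]
    [IsTopologicalRing A] [Ring B] [TopologicalSpace B] [IsTopologicalRing B] (φ : B →+* A)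
    (hφ : Continuous φ) (h : ∀ n, Function.Bijective (GLquotMap φ hφ n)) :
    Function.Bijective (K1.map φ hφ) := by
  constructor
  · intro x y hxy
    induction x, y using DirectLimit.induction₂ with
    | ih n x y =>
      -- Equality in the direct limit is equality at some later stage k, where injectivity is known.
      obtain ⟨k, h1, h2, h3⟩ := Quotient.exact hxy
      dsimp only at h1 h2 h3
      rw [GLquotMap_stabQuot, GLquotMap_stabQuot] at h3
      exact Quotient.sound ⟨k, h1, h2, (h k).1 h3⟩
  · intro y
    induction y using DirectLimit.induction with
    | ih n y =>
      obtain ⟨x, rfl⟩ := (h n).2 y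
      exact ⟨Quotient.mk _ ⟨n, x⟩, rfl⟩

section Banach

variable {A B : Type*} [NormedCommRing A] [NormedAlgebra ℂ A] [CompleteSpace A]
  [NormedCommRing B] [NormedAlgebra ℂ B] [CompleteSpace B]

attribute [local instance] Matrix.linftyOpNormedRing Matrix.linftyOpNormedAlgebra

/-- The uniform structure of the operator norm is the entrywise one, so completeness is inherited
from `R`. -/
theorem completeSpace_matrix_linftyOp {R : Type*} [NormedRing R] [CompleteSpace R] (n : ℕ) :
    @CompleteSpace (Matrix (Fin n) (Fin n) R) PseudoMetricSpace.toUniformSpace :=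
  inferInstanceAs (@CompleteSpace (Matrix (Fin n) (Fin n) R) (Matrix.instUniformSpace _ _ _))

theorem V.map_surjective (φ : B →ₐ[ℂ] A) (hφ : Continuous φ) (hd : DenseRange φ)
    (hu : ∀ b, IsUnit (φ b) → IsUnit b) : Function.Surjective (V.map (φ : B →+* A)) := by
  intro a
  refine Quotient.inductionOn (s := Idem.setoid A) a fun ⟨n, e, he⟩ => ?_
  have hc := completeSpace_matrix_linftyOp (R := A) n
  have hc' := completeSpace_matrix_linftyOp (R := B) n
  obtain ⟨p, hp, ⟨z, z', hzz', hz'z⟩, hz⟩ := exists_idempotent_lift (φ.mapMatrix (m := Fin n))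
    (continuous_id.matrix_map hφ) (denseRange_matrix_map hd)
    (isUnit_of_isUnit_mapMatrix (φ : B →+* A) hu) he
  -- Conjugate idempotents are equivalent: if ze = pz, then (ze)(ez⁻¹) = p and (ez⁻¹)(ze) = e.
  refine ⟨V.mk ⟨n, p, hp⟩, V.sound ⟨z * e, e * z', ?_, ?_⟩⟩
  · change z * e * (e * z') = φ.mapMatrix p
    change z * e = φ.mapMatrix p * z at hz
    rw [← mul_assoc, mul_assoc _ e e, he.eq, hz, mul_assoc, hzz', mul_one]
  · change e * z' * (z * e) = e
    rw [mul_assoc, ← mul_assoc z', hz'z, one_mul, he.eq]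

theorem GLquotMap_bijective (φ : B →ₐ[ℂ] A) (hφ : Continuous φ) (hd : DenseRange φ)
    (hu : ∀ b, IsUnit (φ b) → IsUnit b) (n : ℕ) :
    Function.Bijective (GLquotMap (φ : B →+* A) hφ n) := by
  have hc := completeSpace_matrix_linftyOp (R := A) n
  have hc' := completeSpace_matrix_linftyOp (R := B) n
  have hd' : DenseRange (φ.mapMatrix (m := Fin n)) := denseRange_matrix_map hd
  have hu' := isUnit_of_isUnit_mapMatrix (n := Fin n) (φ : B →+* A) hu
  constructor
  · rw [injective_iff_map_eq_one]
    intro x hx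
    induction x using QuotientGroup.induction_on with
    | H u =>
      exact (QuotientGroup.eq_one_iff (N := GL0 B n) u).2
        (mem_connectedComponentOfOne_of_map_mem (φ.mapMatrix (m := Fin n)) hd' hu'
          ((QuotientGroup.eq_one_iff (N := GL0 A n) (GLmap (φ : B →+* A) n u)).1 hx))
  · intro y
    induction y using QuotientGroup.induction_on with
    | H h =>
      obtain ⟨g, hg⟩ := exists_unit_map_mul_mem (φ.mapMatrix (m := Fin n)) hd' hu' h
      exact ⟨QuotientGroup.mk g, QuotientGroup.eq.2 hg⟩

end Banach

end BanachKTheory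

/-! ### Characters for which the series converges. -/

/-- The terms of the series test whether `‖z‖ ≤ 1`: exponential growth beats the coefficients. -/
theorem norm_le_one_of_tendsto_div {z : ℂ}
    (h : Tendsto (fun k : ℕ => (1 / (4 * (k : ℂ) ^ 2 - 1)) * (z ^ k + z⁻¹ ^ k)) atTop (𝓝 0)) :
    ‖z‖ ≤ 1 := by
  by_contra! hz
  have hz0 : 0 < ‖z‖ := by linarith
  have hinv : ‖z⁻¹‖ ≤ 1 := by rw [norm_inv]; exact inv_le_one_of_one_le₀ hz.le
  have h1 : Tendsto (fun k : ℕ => (k : ℝ) ^ 2 / ‖z‖ ^ k) atTop (𝓝 0) :=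
    tendsto_pow_const_div_const_pow_of_one_lt 2 hz
  have h2 : Tendsto (fun k : ℕ => (1 : ℝ) / ‖z‖ ^ k) atTop (𝓝 0) := by
    simpa using tendsto_pow_const_div_const_pow_of_one_lt 0 hz
  -- With S = |z^k + z^(-k)|, this sequence is at least (S + 1) / |z|^k ≥ 1, because 4k² / (4k² - 1)
  -- ≥ 1 and |z^(-k)| ≤ 1. Yet it tends to 0 when |z| > 1.
  have h3 : Tendsto (fun k : ℕ => ‖(1 / (4 * (k : ℂ) ^ 2 - 1)) * (z ^ k + z⁻¹ ^ k)‖ *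
      (4 * ((k : ℝ) ^ 2 / ‖z‖ ^ k)) + 1 / ‖z‖ ^ k) atTop (𝓝 (‖(0 : ℂ)‖ * (4 * 0) + 0)) :=
    (h.norm.mul (h1.const_mul 4)).add h2
  have h4 : (1 : ℝ) ≤ ‖(0 : ℂ)‖ * (4 * 0) + 0 := by
    refine ge_of_tendsto h3 ?_
    filter_upwards [eventually_ge_atTop 1] with k hk
    have hk' : (1 : ℝ) ≤ k := by exact_mod_cast hk
    have hpow : 0 < ‖z‖ ^ k := by positivity
    have hd : ‖(4 * (k : ℂ) ^ 2 - 1)‖ = 4 * (k : ℝ) ^ 2 - 1 := by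
      rw [show (4 * (k : ℂ) ^ 2 - 1) = ((4 * (k : ℝ) ^ 2 - 1 : ℝ) : ℂ) by push_cast; rfl,
        Complex.norm_real, Real.norm_eq_abs, abs_of_nonneg (by nlinarith)]
    have hd0 : 0 < 4 * (k : ℝ) ^ 2 - 1 := by nlinarith
    have hs : ‖z‖ ^ k ≤ ‖z ^ k + z⁻¹ ^ k‖ + 1 := by
      calc ‖z‖ ^ k = ‖(z ^ k + z⁻¹ ^ k) - z⁻¹ ^ k‖ := by rw [add_sub_cancel_right, norm_pow]
        _ ≤ ‖z ^ k + z⁻¹ ^ k‖ + ‖z⁻¹ ^ k‖ := norm_sub_le _ _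
        _ ≤ ‖z ^ k + z⁻¹ ^ k‖ + 1 := by
          gcongr
          rw [norm_pow]
          exact pow_le_one₀ (norm_nonneg _) hinv
    rw [norm_mul, norm_div, norm_one, hd]
    set S := ‖z ^ k + z⁻¹ ^ k‖
    have hS : 0 ≤ S := norm_nonneg _
    have h5 : S / ‖z‖ ^ k ≤ 1 / (4 * (k : ℝ) ^ 2 - 1) * S * (4 * ((k : ℝ) ^ 2 / ‖z‖ ^ k)) := by
      rw [show 1 / (4 * (k : ℝ) ^ 2 - 1) * S * (4 * ((k : ℝ) ^ 2 / ‖z‖ ^ k)) =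
        S / ‖z‖ ^ k * (4 * (k : ℝ) ^ 2 / (4 * (k : ℝ) ^ 2 - 1)) by ring]
      exact le_mul_of_one_le_right (by positivity) ((one_le_div hd0).2 (by linarith))
    calc (1 : ℝ) = ‖z‖ ^ k / ‖z‖ ^ k := (div_self hpow.ne').symm
      _ ≤ (S + 1) / ‖z‖ ^ k := by gcongr
      _ = S / ‖z‖ ^ k + 1 / ‖z‖ ^ k := add_div _ _ _
      _ ≤ _ := by gcongr
  norm_num at h4

/-- A character at which the Fourier series of `|sin|` converges has values on the unit circle. -/
theorem norm_eq_one_of_tendsto_series {z c b : ℂ} (hc : c ≠ 0) (hz : z ≠ 0)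
    (h : Tendsto (fun N : ℕ => c * (1 - ∑ k ∈ Finset.Icc 1 N,
      (1 / (4 * (k : ℂ) ^ 2 - 1)) * (z ^ k + z⁻¹ ^ k))) atTop (𝓝 b)) : ‖z‖ = 1 := by
  have h1 : Tendsto (fun k : ℕ => (1 / (4 * (k : ℂ) ^ 2 - 1)) * (z ^ k + z⁻¹ ^ k))
      atTop (𝓝 0) := by
    rw [← tendsto_add_atTop_iff_nat 1]
    -- The difference of consecutive partial sums, divided by c, is the term of index N + 1.
    have h2 := ((h.sub (h.comp (tendsto_add_atTop_nat 1))).const_mul c⁻¹)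
    rw [sub_self, mul_zero] at h2
    refine h2.congr fun N => ?_
    simp only [Function.comp_apply]
    rw [Finset.sum_Icc_succ_top (by lia), ← mul_sub, inv_mul_cancel_left₀ hc]
    ring
  refine le_antisymm (norm_le_one_of_tendsto_div h1) ?_
  -- The terms are symmetric under z ↔ z⁻¹.
  have h3 := norm_le_one_of_tendsto_div (z := z⁻¹) (by simpa [add_comm] using h1)
  rw [norm_inv] at h3
  exact (inv_le_one₀ (norm_pos_iff.2 hz)).1 h3

/-! ### The group algebra of ℤⁿ, its completion and the torus. -/

section Torus

variable {n : ℕ}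

theorem mFourier_eq_prod_zpow (θ : UnitAddTorus (Fin n)) (k : Fin n → ℤ) :
    UnitAddTorus.mFourier k θ = ∏ i, (fourier 1 (θ i) : ℂ) ^ k i := by
  simp only [UnitAddTorus.mFourier, ContinuousMap.coe_mk]
  refine Finset.prod_congr rfl fun i _ => ?_
  rw [fourier_apply, fourier_apply, one_smul, AddCircle.toCircle_zsmul, Circle.coe_zpow]

/-- A multiplicative functional on the group algebra of `ℤⁿ`, unimodular on the generators, is
evaluation at a point of the torus. -/
theorem exists_torus_point (χ : AddMonoidAlgebra ℂ (Fin n → ℤ) →ₐ[ℂ] ℂ)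
    (h : ∀ i, ‖χ (AddMonoidAlgebra.single (Pi.single i 1) 1)‖ = 1) :
    ∃ θ : UnitAddTorus (Fin n), ∀ k, χ (AddMonoidAlgebra.single k 1) =
      UnitAddTorus.mFourier k θ := by
  have hθ : ∀ i, ∃ t : UnitAddCircle,
      (fourier 1 t : ℂ) = χ (AddMonoidAlgebra.single (Pi.single i 1) 1) := by
    intro i
    obtain ⟨t, ht⟩ := (AddCircle.homeomorphCircle (one_ne_zero' ℝ)).surjective
      ⟨_, mem_sphere_zero_iff_norm.2 (h i)⟩
    refine ⟨t, ?_⟩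
    rw [fourier_one, ← AddCircle.homeomorphCircle_apply one_ne_zero, ht]
  choose θ hθ using hθ
  refine ⟨θ, fun k => ?_⟩
  -- Working in ℂˣ makes integer powers available, so the values on the basis of ℤⁿ determine all
  -- others.
  let f : Multiplicative (Fin n → ℤ) →* ℂˣ :=
    ((χ : _ →* ℂ).comp (AddMonoidAlgebra.of ℂ (Fin n → ℤ))).toHomUnits
  have hf : ∀ k, (f (Multiplicative.ofAdd k) : ℂ) = χ (AddMonoidAlgebra.single k 1) := fun _ => rfl
  have hk : Multiplicative.ofAdd k =
      ∏ i, Multiplicative.ofAdd (Pi.single i (1 : ℤ) : Fin n → ℤ) ^ k i := by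
    rw [← Finset.univ_sum_single k, ofAdd_sum]
    refine Finset.prod_congr rfl fun i _ => ?_
    rw [← ofAdd_zsmul, Finset.univ_sum_single, ← Pi.single_smul, smul_eq_mul, mul_one]
  rw [← hf, hk, map_prod, Units.coe_prod, mFourier_eq_prod_zpow]
  refine Finset.prod_congr rfl fun i _ => ?_
  rw [map_zpow, Units.val_zpow_eq_zpow_val, hf, hθ]

theorem map_single_natCast_and_neg (χ : AddMonoidAlgebra ℂ (Fin n → ℤ) →ₐ[ℂ] ℂ) (i : Fin n) (k : ℕ) :
    χ (AddMonoidAlgebra.single (Pi.single i (k : ℤ)) 1) =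
        χ (AddMonoidAlgebra.single (Pi.single i 1) 1) ^ k ∧
      χ (AddMonoidAlgebra.single (Pi.single i (-(k : ℤ))) 1) =
        (χ (AddMonoidAlgebra.single (Pi.single i 1) 1))⁻¹ ^ k := by
  have h1 : χ (AddMonoidAlgebra.single (Pi.single i (k : ℤ)) 1) =
      χ (AddMonoidAlgebra.single (Pi.single i 1) 1) ^ k := by
    rw [← map_pow, AddMonoidAlgebra.single_pow, one_pow, ← Pi.single_smul, nsmul_eq_mul, mul_one]
  refine ⟨h1, ?_⟩
  rw [inv_pow, ← h1]
  refine eq_inv_of_mul_eq_one_left ?_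
  rw [← map_mul, AddMonoidAlgebra.single_mul_single, ← Pi.single_add, neg_add_cancel,
    Pi.single_zero, mul_one, ← AddMonoidAlgebra.one_def, map_one]

variable {B : Type*} [NormedCommRing B] [NormedAlgebra ℂ B]
  (η : AddMonoidAlgebra ℂ (Fin n → ℤ) →ₐ[ℂ] B) (ι : B →ₐ[ℂ] C(UnitAddTorus (Fin n), ℂ))

/-- The range contains all trigonometric polynomials, which are dense by Stone–Weierstrass. -/
theorem denseRange_of_mFourier
    (hιη : ∀ k : Fin n → ℤ, ι (η (AddMonoidAlgebra.single k 1)) = UnitAddTorus.mFourier k) :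
    DenseRange ι := by
  have h : Submodule.span ℂ (Set.range (UnitAddTorus.mFourier (d := Fin n))) ≤
      LinearMap.range ι.toLinearMap :=
    Submodule.span_le.2 (by rintro _ ⟨k, rfl⟩; exact ⟨_, hιη k⟩)
  have h2 := Submodule.topologicalClosure_mono h
  rw [UnitAddTorus.span_mFourier_closure_eq_top] at h2
  exact fun x => h2 (Submodule.mem_top (x := x))

/-- If the Fourier series of `|sin (π θᵢ)|` converge in a completion of the group algebra of `ℤⁿ`,
then this completion is inverse-closed in the continuous functions on the torus. -/
theorem isUnit_of_isUnit_map_of_tendsto [CompleteSpace B] (hη : DenseRange η) (hι : Continuous ι)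
    (hιη : ∀ k : Fin n → ℤ, ι (η (AddMonoidAlgebra.single k 1)) = UnitAddTorus.mFourier k)
    (hroot : ∀ i : Fin n, ∃ b : B, Filter.Tendsto
      (fun N : ℕ => ((2 / Real.pi : ℝ) : ℂ) •
        (1 - ∑ k ∈ Finset.Icc 1 N, (1 / (4 * (k : ℂ) ^ 2 - 1)) •
          (η (AddMonoidAlgebra.single (Pi.single i (k : ℤ)) 1) +
            η (AddMonoidAlgebra.single (Pi.single i (-(k : ℤ))) 1))))
      Filter.atTop (nhds b)) (b : B) (hb : IsUnit (ι b)) : IsUnit b := by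
  by_contra hb'
  -- In a commutative complex Banach algebra a non-unit lies in a maximal ideal, which is the kernel
  -- of a character.
  obtain ⟨χ, hχ⟩ := WeakDual.CharacterSpace.exists_apply_eq_zero hb'
  let χ' : B →ₐ[ℂ] ℂ := WeakDual.CharacterSpace.toAlgHom χ
  have hχc : Continuous χ' := map_continuous χ
  have hnorm : ∀ i, ‖(χ'.comp η) (AddMonoidAlgebra.single (Pi.single i 1) 1)‖ = 1 := by
    intro i
    obtain ⟨s, hs⟩ := hroot i
    have h1 := (hχc.tendsto s).comp hs
    refine norm_eq_one_of_tendsto_series (c := ((2 / Real.pi : ℝ) : ℂ)) (b := χ' s) ?_ ?_ ?_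
    · exact_mod_cast (div_pos two_pos Real.pi_pos).ne'
    · intro h0
      have h2 : (χ'.comp η) (AddMonoidAlgebra.single (Pi.single i 1) 1) *
          (χ'.comp η) (AddMonoidAlgebra.single (Pi.single i (-1)) 1) = 1 := by
        rw [← map_mul, AddMonoidAlgebra.single_mul_single, ← Pi.single_add, add_neg_cancel,
          Pi.single_zero, mul_one, ← AddMonoidAlgebra.one_def, map_one]
      rw [h0, zero_mul] at h2
      exact zero_ne_one h2
    · refine h1.congr fun N => ?_
      simp only [Function.comp_apply, map_smul, map_sub, map_one, map_sum, map_add, smul_eq_mul]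
      congr 2
      refine Finset.sum_congr rfl fun k _ => ?_
      rw [← (map_single_natCast_and_neg (χ'.comp η) i k).1, ← (map_single_natCast_and_neg (χ'.comp η) i k).2]
      rfl
  obtain ⟨θ, hθ⟩ := exists_torus_point (χ'.comp η) hnorm
  let ev : B →ₐ[ℂ] ℂ := (ContinuousMap.evalAlgHom ℂ ℂ θ).comp ι
  have hev : Continuous ev := (continuous_eval_const θ).comp hι
  have hcomp : χ'.comp η = ev.comp η := by
    refine AddMonoidAlgebra.algHom_ext (fun k => ?_) (Subsingleton.elim _ _)
    rw [hθ, ← hιη]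
    rfl
  -- Two continuous maps that agree on the dense group algebra coincide.
  have heq : (χ' : B → ℂ) = ev :=
    hη.equalizer hχc hev (funext fun x => DFunLike.congr_fun hcomp x)
  have h0 : ev b = 0 := by rw [← heq]; exact hχ
  exact (hb.map (ContinuousMap.evalAlgHom ℂ ℂ θ)).ne_zero h0

theorem isUnit_iff_and_bijective_K_of_tendsto [CompleteSpace B] (hη : DenseRange η)
    (hι : Continuous ι)
    (hιη : ∀ k : Fin n → ℤ, ι (η (AddMonoidAlgebra.single k 1)) = UnitAddTorus.mFourier k)
    (hroot : ∀ i : Fin n, ∃ b : B, Filter.Tendsto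
      (fun N : ℕ => ((2 / Real.pi : ℝ) : ℂ) •
        (1 - ∑ k ∈ Finset.Icc 1 N, (1 / (4 * (k : ℂ) ^ 2 - 1)) •
          (η (AddMonoidAlgebra.single (Pi.single i (k : ℤ)) 1) +
            η (AddMonoidAlgebra.single (Pi.single i (-(k : ℤ))) 1))))
      Filter.atTop (nhds b)) :
    (∀ b : B, IsUnit (ι b) ↔ IsUnit b) ∧
      Function.Bijective (BanachKTheory.K0.map (ι : B →+* C(UnitAddTorus (Fin n), ℂ))) ∧
      Function.Bijective (BanachKTheory.K1.map (ι : B →+* C(UnitAddTorus (Fin n), ℂ)) hι) := by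
  have hd := denseRange_of_mFourier η ι hιη
  have hu := isUnit_of_isUnit_map_of_tendsto η ι hη hι hιη hroot
  refine ⟨fun b => ⟨hu b, fun h => h.map ι⟩, ?_, ?_⟩
  · exact BanachKTheory.K0.map_bijective_of_V _
      ⟨BanachKTheory.V.map_injective _ hd hu, BanachKTheory.V.map_surjective ι hι hd hu⟩
  · exact BanachKTheory.K1.map_bijective_of_GLquotMap _ hι
      (BanachKTheory.GLquotMap_bijective ι hι hd hu)

end Torus

theorem proposition4
    (n : ℕ) (hn : 1 ≤ n)
    {B : Type*} [NormedRing B] [NormedAlgebra ℂ B] [CompleteSpace B]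
    (η : AddMonoidAlgebra ℂ (Fin n → ℤ) →ₐ[ℂ] B)
    (hη : DenseRange η)
    (ι : B →ₐ[ℂ] C(UnitAddTorus (Fin n), ℂ))
    (hι : Continuous ι) (hι_inj : Function.Injective ι)
    (hιη : ∀ k : Fin n → ℤ, ι (η (AddMonoidAlgebra.single k 1)) = UnitAddTorus.mFourier k)
    (hroot : ∀ i : Fin n, ∃ b : B, Filter.Tendsto
      (fun N : ℕ => ((2 / Real.pi : ℝ) : ℂ) •
        (1 - ∑ k ∈ Finset.Icc 1 N, (1 / (4 * (k : ℂ) ^ 2 - 1)) •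
          (η (AddMonoidAlgebra.single (Pi.single i (k : ℤ)) 1) +
            η (AddMonoidAlgebra.single (Pi.single i (-(k : ℤ))) 1))))
      Filter.atTop (nhds b)) :
    (∀ b : B, IsUnit (ι b) ↔ IsUnit b) ∧
      Function.Bijective (BanachKTheory.K0.map (ι : B →+* C(UnitAddTorus (Fin n), ℂ))) ∧
      Function.Bijective (BanachKTheory.K1.map (ι : B →+* C(UnitAddTorus (Fin n), ℂ)) hι) := by
  -- Injectivity of ι transports commutativity from the function algebra to `B`, which the character
  -- and determinant arguments require.
  let _ : NormedCommRing B :=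
    { ‹NormedRing B› with
      mul_comm := fun x y => hι_inj (by rw [map_mul, map_mul, mul_comm]) }
  exact isUnit_iff_and_bijective_K_of_tendsto η ι hη hι hιη hroot
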